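/- Let $\Gamma$ be a countable discrete group acting by homeomorphisms on a compact Hausdorff space $X$. Let $C_c(X\rtimes\Gamma)$ be the convolution $*$-algebra of finite formal sums $\sum f_s s$, $f_s\in C(X)$, $s\in\Gamma$ (so that $sfs^{-1}=s.f$ with $(s.f)(x)=f(s^{-1}x)$, and $s^*=s^{-1}$), and let $C^*(X\rtimes\Gamma)$ be the full crossed product, i.e. its completion in the norm $\|a\|=\sup\{\|\pi(a)\| : \pi \text{ a } *\text{-representation on a Hilbert space}\}$. Let $\pi\colon C^*(X\rtimes\Gamma)\to\mathbb B(\mathcal H)$ be a covariant representation (a unital $*$-homomorphism, $\mathcal H$ a Hilbert space) whose restriction $\pi|_\Gamma$, a unitary representation of $\Gamma$, weakly contains the trivial representation of $\Gamma$. Then: 1. the action of $\Gamma$ on $X$ is amenable if and only if $\Gamma$ is amenable; 2. the action of $\Gamma$ on $X$ is a-T-menable if and only if $\Gamma$ is a-T-menable. Here a function $h\colon X\times\Gamma\to\mathbb C$ is positive definite if for all $s_1,\dots,s_n\in\Gamma$ and $x\in X$ the matrix $[h(s_i.x,s_is_j^{-1})]_{i,j}$ is positive semidefinite; the action is amenable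 (respectively a-T-menable) if there are positive definite functions $h_n\in C_c(X\times\Gamma)$ (respectively $h_n\in C_0(X\times\Gamma)$) such that $h_n\to1$ uniformly on compact sets. A function $h\colon\Gamma\to\mathbb C$ is positive definite if all matrices $[h(s_is_j^{-1})]_{i,j}$ are positive semidefinite; $\Gamma$ is amenable (respectively a-T-menable, i.e. has the Haagerup property) if there are positive definite functions $h_n\in c_c(\Gamma)$ (respectively $h_n\in c_0(\Gamma)$) converging pointwise to $1$. A unitary representation $\pi$ weakly contains a unitary representation $\sigma$ if every diagonal matrix coefficient $s\mapsto\langle\sigma_s\xi,\xi\rangle$ is approximated, uniformly on finite subsets of $\Gamma$, by finite sums of diagonal matrix coefficients of $\pi$. -/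

import Mathlib

open Filter Topology
open scoped ComplexOrder CompactlySupported ZeroAtInfty

universe u v w

noncomputable section

namespace CrossedProduct

section Group

variable {Γ : Type u} [Group Γ]

/-- A function `h` on the group `Γ` is positive definite if all the matrices
`[h (sᵢ sⱼ⁻¹)]` are positive semidefinite. -/
def IsPositiveDefinite (h : Γ → ℂ) : Prop :=
  ∀ (n : ℕ) (s : Fin n → Γ),
    (Matrix.of fun i j : Fin n => h (s i * (s j)⁻¹)).PosSemidef

variable (Γ) in
/-- Amenability of `Γ`: there are positive definite functions of finite support
converging pointwise to one. -/
def IsAmenableGroup : Prop :=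
  ∃ h : ℕ → Γ → ℂ,
    (∀ n, IsPositiveDefinite (h n)) ∧
    (∀ n, (Function.support (h n)).Finite) ∧
    ∀ s, Tendsto (fun n => h n s) atTop (𝓝 1)

variable (Γ) in
/-- a-T-menability (the Haagerup property) of `Γ`: there are positive definite functions
vanishing at infinity converging pointwise to one. -/
def IsATMenableGroup : Prop :=
  ∃ h : ℕ → Γ → ℂ,
    (∀ n, IsPositiveDefinite (h n)) ∧
    (∀ n, Tendsto (h n) cofinite (𝓝 0)) ∧
    ∀ s, Tendsto (fun n => h n s) atTop (𝓝 1)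

/-- The unitary representation `π` weakly contains the unitary representation `σ`: each diagonal
matrix coefficient of `σ` can be approximated, uniformly on finite subsets of `Γ`, by finite sums
of diagonal matrix coefficients of `π`. -/
def WeaklyContains
    {H : Type*} [NormedAddCommGroup H] [InnerProductSpace ℂ H] [CompleteSpace H]
    {K : Type*} [NormedAddCommGroup K] [InnerProductSpace ℂ K] [CompleteSpace K]
    (π : Γ →* unitary (H →L[ℂ] H)) (σ : Γ →* unitary (K →L[ℂ] K)) : Prop :=
  ∀ (ξ : K) (Q : Finset Γ) (ε : ℝ), 0 < ε →
    ∃ (m : ℕ) (η : Fin m → H), ∀ s ∈ Q,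
      ‖inner ℂ ξ ((σ s : K →L[ℂ] K) ξ) - ∑ i, inner ℂ (η i) ((π s : H →L[ℂ] H) (η i))‖ < ε

variable (Γ) in
/-- The trivial (one-dimensional) unitary representation of `Γ`. -/
def trivialRep : Γ →* unitary (ℂ →L[ℂ] ℂ) := 1

end Group

section Action

variable (Γ : Type u) (X : Type v) [Group Γ] [TopologicalSpace X] [MulAction Γ X]

variable {Γ X} in
/-- A function `h` on `X × Γ` is positive definite if all the matrices
`[h (sᵢ.x, sᵢ sⱼ⁻¹)]` are positive semidefinite. -/
def IsPositiveDefiniteOn (h : X × Γ → ℂ) : Prop :=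
  ∀ (n : ℕ) (s : Fin n → Γ) (x : X),
    (Matrix.of fun i j : Fin n => h (s i • x, s i * (s j)⁻¹)).PosSemidef

/-- Amenability of the action of `Γ` on `X`. -/
def IsAmenableAction [TopologicalSpace Γ] : Prop :=
  ∃ h : ℕ → C_c(X × Γ, ℂ),
    (∀ n, IsPositiveDefiniteOn (h n : X × Γ → ℂ)) ∧
    ∀ K : Set (X × Γ), IsCompact K →
      TendstoUniformlyOn (fun n p => h n p) (fun _ => 1) atTop K

/-- a-T-menability of the action of `Γ` on `X`. -/
def IsATMenableAction [TopologicalSpace Γ] : Prop :=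
  ∃ h : ℕ → C₀(X × Γ, ℂ),
    (∀ n, IsPositiveDefiniteOn (h n : X × Γ → ℂ)) ∧
    ∀ K : Set (X × Γ), IsCompact K →
      TendstoUniformlyOn (fun n p => h n p) (fun _ => 1) atTop K

end Action

section Algebra

/-- An action of `Γ` on a C*-algebra `B` by ring automorphisms is an action by *-automorphisms if
it is compatible with the scalars and with the involution. -/
class IsStarAction (Γ : Type u) (B : Type v) [Group Γ] [CStarAlgebra B]
    [MulSemiringAction Γ B] : Prop extends SMulCommClass Γ ℂ B where
  star_smul_eq : ∀ (s : Γ) (f : B), star (s • f) = s • star f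

variable (Γ : Type u) (B : Type v) [Group Γ] [CStarAlgebra B] [MulSemiringAction Γ B]

/-- The convolution algebra of an action of the discrete group `Γ` on `B`: finite formal sums
`∑ f_s s` with `f_s ∈ B` (`SkewMonoidAlgebra.single s f` is `f s`), with the product
`(f s) (g t) = f (s • g) (s t)`. -/
abbrev ConvAlgebra : Type (max u v) := SkewMonoidAlgebra B Γ

variable {Γ B}

/-- The involution of the convolution algebra, as an additive map:
`(f s)^* = (s⁻¹ • f^*) s⁻¹`. -/
def starHom : ConvAlgebra Γ B →+ ConvAlgebra Γ B :=
  (Finsupp.liftAddHom fun s : Γ =>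
    (SkewMonoidAlgebra.singleAddHom s⁻¹).comp
      ((DistribSMul.toAddMonoidHom B s⁻¹).comp
        (starAddEquiv : B ≃+ B).toAddMonoidHom)).comp
    SkewMonoidAlgebra.coeffAddEquiv.toAddMonoidHom

theorem starHom_single (s : Γ) (f : B) :
    starHom (SkewMonoidAlgebra.single s f : ConvAlgebra Γ B) =
      SkewMonoidAlgebra.single s⁻¹ (s⁻¹ • star f) := by
  simp [starHom, SkewMonoidAlgebra.coeffAddEquiv, SkewMonoidAlgebra.singleAddHom]

instance : Star (ConvAlgebra Γ B) := ⟨starHom⟩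

theorem star_single (s : Γ) (f : B) :
    star (SkewMonoidAlgebra.single s f : ConvAlgebra Γ B) =
      SkewMonoidAlgebra.single s⁻¹ (s⁻¹ • star f) := starHom_single s f

theorem conv_star_add (a b : ConvAlgebra Γ B) : star (a + b) = star a + star b :=
  map_add starHom a b

theorem conv_star_zero : star (0 : ConvAlgebra Γ B) = 0 := map_zero starHom

variable [IsStarAction Γ B]

instance : StarRing (ConvAlgebra Γ B) where
  star_involutive a := by
    induction a using SkewMonoidAlgebra.induction_on with
    | zero => rw [conv_star_zero, conv_star_zero]
    | single s f => simp [star_single, IsStarAction.star_smul_eq]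
    | add a b ha hb => rw [conv_star_add, conv_star_add, ha, hb]
  star_mul a b := by
    induction a using SkewMonoidAlgebra.induction_on with
    | zero => rw [zero_mul, conv_star_zero, mul_zero]
    | add a a' ha ha' => rw [add_mul, conv_star_add, conv_star_add, mul_add, ha, ha']
    | single s f =>
      induction b using SkewMonoidAlgebra.induction_on with
      | zero => rw [mul_zero, conv_star_zero, zero_mul]
      | add b b' hb hb' => rw [mul_add, conv_star_add, conv_star_add, add_mul, hb, hb']
      | single t g =>
        simp [star_single, SkewMonoidAlgebra.single_mul_single, IsStarAction.star_smul_eq,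
          smul_mul', mul_smul]
  star_add := conv_star_add

instance : StarModule ℂ (ConvAlgebra Γ B) where
  star_smul c a := by
    induction a using SkewMonoidAlgebra.induction_on with
    | zero => rw [smul_zero, conv_star_zero, smul_zero]
    | add a b ha hb => rw [smul_add, conv_star_add, conv_star_add, smul_add, ha, hb]
    | single s f =>
      rw [SkewMonoidAlgebra.smul_single, star_single, star_single, SkewMonoidAlgebra.smul_single,
        star_smul, smul_comm]

/-- `Γ` as a group of unitaries of the convolution algebra. -/
def groupUnitary : Γ →* unitary (ConvAlgebra Γ B) where
  toFun s := ⟨SkewMonoidAlgebra.single s 1, by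
    rw [Unitary.mem_iff]
    simp [star_single, SkewMonoidAlgebra.single_mul_single]⟩
  map_one' := rfl
  map_mul' s t := by
    ext1
    simp [SkewMonoidAlgebra.single_mul_single]

/-- The inclusion of `B` in the convolution algebra. -/
def functionHom : B →⋆ₐ[ℂ] ConvAlgebra Γ B where
  toFun f := SkewMonoidAlgebra.single 1 f
  map_one' := rfl
  map_mul' f g := by simp [SkewMonoidAlgebra.single_mul_single]
  map_zero' := by simp
  map_add' f g := by simp [SkewMonoidAlgebra.single_add]
  commutes' _ := rfl
  map_star' f := by simp [star_single]

theorem functionHom_mul_groupUnitary (f : B) (s : Γ) :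
    functionHom f * ((groupUnitary s : unitary (ConvAlgebra Γ B)) : ConvAlgebra Γ B) =
      SkewMonoidAlgebra.single s f := by
  change SkewMonoidAlgebra.single 1 f * SkewMonoidAlgebra.single s 1 = _
  simp [SkewMonoidAlgebra.single_mul_single]

/-- The values `‖π a‖`, where `π` runs through the *-representations of the convolution algebra on
Hilbert spaces. -/
def repNorms (a : ConvAlgebra Γ B) : Set ℝ :=
  {r | ∃ (H : Type (max u v)) (_ : NormedAddCommGroup H) (_ : InnerProductSpace ℂ H)
    (_ : CompleteSpace H) (π : ConvAlgebra Γ B →⋆ₐ[ℂ] (H →L[ℂ] H)), r = ‖π a‖}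

/-- The universal C*-norm `‖a‖ = sup {‖π a‖ : π a *-representation}`. -/
def universalNorm (a : ConvAlgebra Γ B) : ℝ := sSup (repNorms a)

theorem repNorms_nonempty (a : ConvAlgebra Γ B) : (repNorms a).Nonempty :=
  ⟨_, PUnit, inferInstance, inferInstance, inferInstance,
    { toFun := fun _ => 0
      map_one' := Subsingleton.elim _ _
      map_mul' := fun _ _ => Subsingleton.elim _ _
      map_zero' := rfl
      map_add' := fun _ _ => Subsingleton.elim _ _
      commutes' := fun _ => Subsingleton.elim _ _
      map_star' := fun _ => Subsingleton.elim _ _ }, rfl⟩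

theorem norm_rep_unitary_le {A : Type*} [Ring A] [StarRing A] [Algebra ℂ A]
    {H : Type*} [NormedAddCommGroup H] [InnerProductSpace ℂ H] [CompleteSpace H]
    (π : A →⋆ₐ[ℂ] (H →L[ℂ] H)) (x : unitary A) : ‖π x‖ ≤ 1 := by
  have h : ‖π x‖ * ‖π x‖ ≤ 1 := by
    rw [← CStarRing.norm_star_mul_self, ← map_star, ← map_mul, Unitary.coe_star_mul_self, map_one]
    exact ContinuousLinearMap.norm_id_le
  nlinarith [norm_nonneg (π x)]

theorem repNorms_bddAbove (a : ConvAlgebra Γ B) : BddAbove (repNorms a) := by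
  refine ⟨∑ s ∈ a.support, ‖a.coeff s‖, ?_⟩
  rintro _ ⟨H, _, _, _, π, rfl⟩
  have ha : a = ∑ s ∈ a.support, functionHom (a.coeff s) *
      ((groupUnitary s : unitary (ConvAlgebra Γ B)) : ConvAlgebra Γ B) := by
    simp_rw [functionHom_mul_groupUnitary]
    exact (SkewMonoidAlgebra.sum_single a).symm
  conv_lhs => rw [ha, map_sum]
  refine (norm_sum_le _ _).trans (Finset.sum_le_sum fun s _ => ?_)
  rw [map_mul]
  refine (norm_mul_le _ _).trans ?_
  have h1 : ‖(π.comp functionHom) (a.coeff s)‖ ≤ ‖a.coeff s‖ :=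
    NonUnitalStarAlgHom.norm_apply_le _ _
  have h2 := norm_rep_unitary_le π (groupUnitary s)
  calc _ ≤ ‖a.coeff s‖ * 1 := mul_le_mul h1 h2 (norm_nonneg _) (norm_nonneg _)
    _ = _ := mul_one _

theorem le_universalNorm {a : ConvAlgebra Γ B} {r : ℝ} (h : r ∈ repNorms a) :
    r ≤ universalNorm a := le_csSup (repNorms_bddAbove a) h

theorem universalNorm_le {a : ConvAlgebra Γ B} {r : ℝ} (h : ∀ x ∈ repNorms a, x ≤ r) :
    universalNorm a ≤ r := csSup_le (repNorms_nonempty a) h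

theorem universalNorm_nonneg (a : ConvAlgebra Γ B) : 0 ≤ universalNorm a := by
  apply Real.sSup_nonneg
  rintro _ ⟨H, _, _, _, π, rfl⟩
  exact norm_nonneg _

variable (Γ B) in
/-- The universal norm as a ring seminorm. -/
def universalSeminorm : RingSeminorm (ConvAlgebra Γ B) where
  toFun := universalNorm
  map_zero' := by
    refine le_antisymm (universalNorm_le ?_) (universalNorm_nonneg _)
    rintro _ ⟨H, _, _, _, π, rfl⟩
    simp
  add_le' a b := by
    refine universalNorm_le ?_
    rintro _ ⟨H, _, _, _, π, rfl⟩
    rw [map_add]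
    exact (norm_add_le _ _).trans (add_le_add (le_universalNorm ⟨H, _, _, _, π, rfl⟩)
      (le_universalNorm ⟨H, _, _, _, π, rfl⟩))
  neg' a := by
    simp [universalNorm, repNorms]
  mul_le' a b := by
    refine universalNorm_le ?_
    rintro _ ⟨H, _, _, _, π, rfl⟩
    rw [map_mul]
    exact (norm_mul_le _ _).trans (mul_le_mul (le_universalNorm ⟨H, _, _, _, π, rfl⟩)
      (le_universalNorm ⟨H, _, _, _, π, rfl⟩) (norm_nonneg _) (universalNorm_nonneg _))

instance : SeminormedRing (ConvAlgebra Γ B) := (universalSeminorm Γ B).toSeminormedRing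

theorem norm_def (a : ConvAlgebra Γ B) : ‖a‖ = universalNorm a := rfl

instance : NormedSpace ℂ (ConvAlgebra Γ B) where
  norm_smul_le c a := by
    refine universalNorm_le ?_
    rintro _ ⟨H, _, _, _, π, rfl⟩
    rw [map_smul, norm_smul]
    exact mul_le_mul_of_nonneg_left (le_universalNorm ⟨H, _, _, _, π, rfl⟩) (norm_nonneg _)

theorem norm_star_eq (a : ConvAlgebra Γ B) : ‖star a‖ = ‖a‖ := by
  simp [norm_def, universalNorm, repNorms, map_star]

theorem norm_mul_self_le_norm (a : ConvAlgebra Γ B) : ‖a‖ * ‖a‖ ≤ ‖star a * a‖ := by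
  rw [← sq, ← Real.le_sqrt (norm_nonneg _) (norm_nonneg _)]
  refine universalNorm_le ?_
  rintro _ ⟨H, _, _, _, π, rfl⟩
  rw [Real.le_sqrt (norm_nonneg _) (norm_nonneg _), sq, ← CStarRing.norm_star_mul_self,
    ← map_star, ← map_mul]
  exact le_universalNorm ⟨H, _, _, _, π, rfl⟩

variable (Γ B)

/-- The full crossed product C*-algebra: the completion of the convolution algebra with respect to
the universal C*-norm. -/
abbrev FullCrossedProduct : Type (max u v) := UniformSpace.Completion (ConvAlgebra Γ B)

variable {Γ B}

theorem uniformContinuous_star_conv :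
    UniformContinuous (star : ConvAlgebra Γ B → ConvAlgebra Γ B) :=
  (AddMonoidHomClass.isometry_of_norm (starHom : ConvAlgebra Γ B →+ ConvAlgebra Γ B)
    norm_star_eq).uniformContinuous

instance : Star (FullCrossedProduct Γ B) := ⟨UniformSpace.Completion.map star⟩

theorem coe_star (a : ConvAlgebra Γ B) :
    ((star a : ConvAlgebra Γ B) : FullCrossedProduct Γ B) = star (a : FullCrossedProduct Γ B) :=
  (UniformSpace.Completion.map_coe uniformContinuous_star_conv a).symm

theorem continuous_star_completion :
    Continuous (star : FullCrossedProduct Γ B → FullCrossedProduct Γ B) :=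
  UniformSpace.Completion.continuous_map

theorem full_star_smul (c : ℂ) (x : FullCrossedProduct Γ B) :
    star (c • x) = star c • star x := by
  have h1 : Continuous fun y : FullCrossedProduct Γ B => star (c • y) :=
    continuous_star_completion.comp (continuous_const_smul c)
  have h2 : Continuous fun y : FullCrossedProduct Γ B => star c • star y :=
    (continuous_const_smul (star c)).comp continuous_star_completion
  induction x using UniformSpace.Completion.induction_on with
  | hp => exact isClosed_eq h1 h2
  | ih a =>
    rw [← UniformSpace.Completion.coe_smul, ← coe_star, ← coe_star,
      ← UniformSpace.Completion.coe_smul, star_smul]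

instance : CStarAlgebra (FullCrossedProduct Γ B) where
  norm_smul_le := norm_smul_le
  star_involutive x := by
    induction x using UniformSpace.Completion.induction_on with
    | hp =>
      exact isClosed_eq (f := fun y => star (star y))
        (continuous_star_completion.comp continuous_star_completion)
        continuous_id
    | ih a => rw [← coe_star, ← coe_star, star_star]
  star_mul x y := by
    induction x, y using UniformSpace.Completion.induction_on₂ with
    | hp =>
      exact isClosed_eq (continuous_star_completion.comp (by fun_prop))
        ((continuous_star_completion.comp continuous_snd).mul
          (continuous_star_completion.comp continuous_fst))
    | ih a b => simp only [← coe_star, ← UniformSpace.Completion.coe_mul, star_mul]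
  star_add x y := by
    induction x, y using UniformSpace.Completion.induction_on₂ with
    | hp =>
      exact isClosed_eq (continuous_star_completion.comp (by fun_prop))
        ((continuous_star_completion.comp continuous_fst).add
          (continuous_star_completion.comp continuous_snd))
    | ih a b => simp only [← coe_star, ← UniformSpace.Completion.coe_add, star_add]
  star_smul := full_star_smul
  norm_mul_self_le x := by
    induction x using UniformSpace.Completion.induction_on with
    | hp =>
      exact isClosed_le (by fun_prop)
        ((continuous_star_completion.mul continuous_id).norm)
    | ih a =>
      simp only [← coe_star, ← UniformSpace.Completion.coe_mul, UniformSpace.Completion.norm_coe]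
      exact norm_mul_self_le_norm a

/-- The canonical *-homomorphism from the convolution algebra to the full crossed product. -/
def toFull : ConvAlgebra Γ B →⋆ₐ[ℂ] FullCrossedProduct Γ B where
  toFun a := a
  map_one' := rfl
  map_mul' a b := UniformSpace.Completion.coe_mul a b
  map_zero' := rfl
  map_add' a b := UniformSpace.Completion.coe_add a b
  commutes' _ := rfl
  map_star' a := coe_star a

/-- The restriction `π|_Γ` of a representation of the full crossed product to `Γ`. -/
def restrictGroup {H : Type w} [NormedAddCommGroup H] [InnerProductSpace ℂ H] [CompleteSpace H]
    (π : FullCrossedProduct Γ B →⋆ₐ[ℂ] (H →L[ℂ] H)) : Γ →* unitary (H →L[ℂ] H) where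
  toFun s := ⟨π (toFull ((groupUnitary s : unitary (ConvAlgebra Γ B)) : ConvAlgebra Γ B)), by
    constructor <;> rw [← map_star, ← map_star, ← map_mul, ← map_mul] <;> simp⟩
  map_one' := by ext1; simp
  map_mul' s t := by ext1; simp

end Algebra

section Functions

variable (Γ : Type u) (X : Type v) [Group Γ] [TopologicalSpace X] [MulAction Γ X]
  [ContinuousConstSMul Γ X]

/-- The action of `Γ` on `C(X)` by `(s • f) x = f (s⁻¹ • x)`. -/
instance translationAction : MulSemiringAction Γ C(X, ℂ) where
  smul s f := ⟨fun x => f (s⁻¹ • x), by fun_prop⟩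
  one_smul f := by ext x; change f ((1 : Γ)⁻¹ • x) = f x; simp
  mul_smul s t f := by
    ext x; change f ((s * t)⁻¹ • x) = f (t⁻¹ • s⁻¹ • x); simp [mul_smul]
  smul_zero _ := rfl
  smul_add _ _ _ := rfl
  smul_one _ := rfl
  smul_mul _ _ _ := rfl

theorem translation_apply (s : Γ) (f : C(X, ℂ)) (x : X) : (s • f) x = f (s⁻¹ • x) := rfl

variable [CompactSpace X]

instance : IsStarAction Γ C(X, ℂ) where
  smul_comm _ _ _ := rfl
  star_smul_eq _ _ := rfl

/-- The full crossed product `C*(X ⋊ Γ)`. -/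
abbrev CStarCrossed : Type (max u v) := FullCrossedProduct Γ C(X, ℂ)

end Functions

end CrossedProduct

end

/-! Finite sums of diagonal coefficients of `π|_Γ` that approximate the constant `1` come from
vectors that are almost invariant in the mean. Viewed as functionals on all bounded operators, they
are therefore almost invariant under conjugation by `Γ`, and a limit along an ultrafilter is an
exactly invariant state (`exists_invariant_state`). By covariance its restriction to `C(X)` is a
`Γ`-invariant mean `μ` (`exists_invariant_mean`).

Averaging over `X` with `μ` turns a positive definite `h` on `X × Γ` into the function `s ↦ μ (h (·,
s))` on `Γ`. Invariance of `μ` preserves positive definiteness (`IsPositiveDefiniteOn.mean`),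
contractivity preserves decay and finiteness of support, and `μ 1 = 1` preserves convergence to `1`.
Conversely, functions on `Γ` pull back to `X × Γ`; compactness of `X` keeps the support compact or
the decay at infinity, and no representation is needed. -/

namespace CrossedProduct

/-! ### Almost invariant vectors and invariant states on bounded operators. -/

section InvariantState

variable {H : Type*} [NormedAddCommGroup H] [InnerProductSpace ℂ H]

/-- The positive functional `A ↦ ∑ᵢ ⟪ηᵢ, A ηᵢ⟫` on the bounded operators. -/
noncomputable def vectorFunctional {m : ℕ} (η : Fin m → H) : (H →L[ℂ] H) →ₗ[ℂ] ℂ where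
  toFun A := ∑ i, inner ℂ (η i) (A (η i))
  map_add' A B := by simp [Finset.sum_add_distrib]
  map_smul' c A := by simp [Finset.mul_sum]

theorem vectorFunctional_apply {m : ℕ} (η : Fin m → H) (A : H →L[ℂ] H) :
    vectorFunctional η A = ∑ i, inner ℂ (η i) (A (η i)) := rfl

theorem vectorFunctional_one {m : ℕ} (η : Fin m → H) :
    vectorFunctional η 1 = ((∑ i, ‖η i‖ ^ 2 : ℝ) : ℂ) := by
  simp [vectorFunctional_apply, inner_self_eq_norm_sq_to_K]

theorem norm_vectorFunctional_le {m : ℕ} (η : Fin m → H) (A : H →L[ℂ] H) :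
    ‖vectorFunctional η A‖ ≤ ‖A‖ * ∑ i, ‖η i‖ ^ 2 := by
  rw [vectorFunctional_apply, Finset.mul_sum]
  refine (norm_sum_le _ _).trans (Finset.sum_le_sum fun i _ => ?_)
  calc ‖inner ℂ (η i) (A (η i))‖ ≤ ‖η i‖ * ‖A (η i)‖ := norm_inner_le_norm _ _
    _ ≤ ‖η i‖ * (‖A‖ * ‖η i‖) := by gcongr; exact A.le_opNorm _
    _ = ‖A‖ * ‖η i‖ ^ 2 := by ring

variable [CompleteSpace H]

theorem vectorFunctional_star {m : ℕ} (η : Fin m → H) (A : H →L[ℂ] H) :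
    vectorFunctional η (star A) = star (vectorFunctional η A) := by
  simp [vectorFunctional_apply, ContinuousLinearMap.star_eq_adjoint,
    ContinuousLinearMap.adjoint_inner_right]

theorem vectorFunctional_star_mul_self_nonneg {m : ℕ} (η : Fin m → H) (A : H →L[ℂ] H) :
    0 ≤ vectorFunctional η (star A * A) := by
  rw [vectorFunctional_apply]
  refine Finset.sum_nonneg fun i _ => ?_
  rw [mul_apply_eq_comp, ContinuousLinearMap.star_eq_adjoint,
    ContinuousLinearMap.adjoint_inner_right, inner_self_eq_norm_sq_to_K]
  exact pow_nonneg (Complex.zero_le_real.2 (norm_nonneg (A (η i)))) 2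

/-- Converts closeness of the coefficients at `1` and at `u` into almost invariance of the vectors
`η i` under `star u`. -/
theorem sum_norm_unitary_star_sub_sq {m : ℕ} (η : Fin m → H) (u : unitary (H →L[ℂ] H)) :
    ∑ i, ‖star (u : H →L[ℂ] H) (η i) - η i‖ ^ 2 =
      2 * (vectorFunctional η 1).re - 2 * (vectorFunctional η (u : H →L[ℂ] H)).re := by
  simp only [vectorFunctional_apply, Complex.re_sum, Finset.mul_sum, ← Finset.sum_sub_distrib]
  refine Finset.sum_congr rfl fun i _ => ?_
  have h1 : ‖star (u : H →L[ℂ] H) (η i)‖ = ‖η i‖ :=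
    ContinuousLinearMap.norm_map_of_mem_unitary (star u).2 (η i)
  have h2 : inner ℂ (star (u : H →L[ℂ] H) (η i)) (η i) =
      inner ℂ (η i) ((u : H →L[ℂ] H) (η i)) := by
    rw [ContinuousLinearMap.star_eq_adjoint, ContinuousLinearMap.adjoint_inner_left]
  have h3 : (inner ℂ (η i) ((1 : H →L[ℂ] H) (η i))).re = ‖η i‖ ^ 2 :=
    inner_self_eq_norm_sq (𝕜 := ℂ) (η i)
  rw [@norm_sub_sq ℂ, h1, h2, h3]
  change _ - 2 * (inner ℂ (η i) ((u : H →L[ℂ] H) (η i))).re + _ = _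
  ring

/-- Conjugation by `u` replaces each `η i` by `star u (η i)`, so the error is linear in the
displacements `d i`, and Cauchy–Schwarz over `i` bounds it. The first square root tends to `0` once
the values at `1` and at `u` both tend to `1`. -/
theorem norm_vectorFunctional_conj_sub_le {m : ℕ} (η : Fin m → H) (u : unitary (H →L[ℂ] H))
    (A : H →L[ℂ] H) :
    ‖vectorFunctional η (u * A * star (u : H →L[ℂ] H)) - vectorFunctional η A‖ ≤
      2 * ‖A‖ * (√(2 * (vectorFunctional η 1).re - 2 * (vectorFunctional η (u : H →L[ℂ] H)).re) *
        √((vectorFunctional η 1).re)) := by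
  set d : Fin m → H := fun i => star (u : H →L[ℂ] H) (η i) - η i with hd
  have key : ‖vectorFunctional η (u * A * star (u : H →L[ℂ] H)) - vectorFunctional η A‖ ≤
      2 * ‖A‖ * ∑ i, ‖d i‖ * ‖η i‖ := by
    simp only [vectorFunctional_apply, ← Finset.sum_sub_distrib, Finset.mul_sum]
    refine (norm_sum_le _ _).trans (Finset.sum_le_sum fun i _ => ?_)
    set y := star (u : H →L[ℂ] H) (η i) with hy
    have h1 : ‖y‖ = ‖η i‖ := ContinuousLinearMap.norm_map_of_mem_unitary (star u).2 (η i)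
    have h2 : inner ℂ (η i) (((u : H →L[ℂ] H) * A * star (u : H →L[ℂ] H)) (η i)) =
        inner ℂ y (A y) := by
      rw [hy, ContinuousLinearMap.star_eq_adjoint, ContinuousLinearMap.adjoint_inner_left]
      rfl
    -- Telescoping with `y = η i + d i`: each term keeps exactly one factor `d i`.
    have h3 : inner ℂ y (A y) - inner ℂ (η i) (A (η i)) =
        inner ℂ (d i) (A y) + inner ℂ (η i) (A (d i)) := by
      simp only [hd, ← hy, inner_sub_left, map_sub, inner_sub_right]
      ring
    rw [h2, h3]
    calc _ ≤ ‖d i‖ * ‖A y‖ + ‖η i‖ * ‖A (d i)‖ :=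
          (norm_add_le _ _).trans (add_le_add (norm_inner_le_norm _ _) (norm_inner_le_norm _ _))
      _ ≤ ‖d i‖ * (‖A‖ * ‖y‖) + ‖η i‖ * (‖A‖ * ‖d i‖) := by
          gcongr <;> exact A.le_opNorm _
      _ = 2 * ‖A‖ * (‖d i‖ * ‖η i‖) := by rw [h1]; ring
  refine key.trans (mul_le_mul_of_nonneg_left ?_ (by positivity))
  rw [← sum_norm_unitary_star_sub_sq η u, vectorFunctional_one, Complex.ofReal_re]
  exact Real.sum_mul_le_sqrt_mul_sqrt _ _ _

/-- A unitary representation weakly containing the trivial representation admits an invariant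
state on the bounded operators. -/
theorem exists_invariant_state {Γ : Type*} [Group Γ] (U : Γ →* unitary (H →L[ℂ] H))
    (hU : WeaklyContains U (trivialRep Γ)) :
    ∃ φ : (H →L[ℂ] H) →ₗ[ℂ] ℂ, φ 1 = 1 ∧ (∀ A, ‖φ A‖ ≤ ‖A‖) ∧
      (∀ A, φ (star A) = star (φ A)) ∧ (∀ A, 0 ≤ φ (star A * A)) ∧
      ∀ s A, φ (U s * A * star (U s : H →L[ℂ] H)) = φ A := by
  classical
  -- The pair `(Q, n)` indexes an approximation on `Q` with error `1 / (n + 1)`; the product order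
  -- sends both parameters to infinity.
  choose m η hη using fun i : Finset Γ × ℕ => hU 1 i.1 (1 / ((i.2 : ℝ) + 1)) (by positivity)
  set ψ : Finset Γ × ℕ → (H →L[ℂ] H) →ₗ[ℂ] ℂ := fun i => vectorFunctional (η i) with hψ
  have lim1 (s : Γ) : Tendsto (fun i => ψ i (U s)) atTop (𝓝 1) := by
    have h0 : Tendsto (fun i : Finset Γ × ℕ => 1 / ((i.2 : ℝ) + 1)) atTop (𝓝 0) :=
      tendsto_one_div_add_atTop_nhds_zero_nat.comp
        ((prod_atTop_atTop_eq (α := Finset Γ) (β := ℕ)).symm ▸ tendsto_snd)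
    rw [tendsto_iff_norm_sub_tendsto_zero]
    refine squeeze_zero' (Eventually.of_forall fun _ => norm_nonneg _) ?_ h0
    filter_upwards [eventually_ge_atTop (({s}, 0) : Finset Γ × ℕ)] with i hi
    have := (hη i s (Finset.singleton_subset_iff.1 hi.1)).le
    rw [norm_sub_rev]
    simpa [trivialRep, hψ, vectorFunctional_apply] using this
  -- The vectors are not normalised; the coefficient at the identity forces their total squared norm
  -- to tend to `1`.
  have limone : Tendsto (fun i => ψ i 1) atTop (𝓝 1) := by simpa using lim1 1
  have limre (s : Γ) : Tendsto (fun i => (ψ i (U s)).re) atTop (𝓝 1) :=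
    (Complex.continuous_re.tendsto 1).comp (lim1 s)
  have limone' : Tendsto (fun i => (ψ i 1).re) atTop (𝓝 1) :=
    (Complex.continuous_re.tendsto 1).comp limone
  have bound (i) (A : H →L[ℂ] H) : ‖ψ i A‖ ≤ ‖A‖ * (ψ i 1).re := by
    simpa only [hψ, vectorFunctional_one, Complex.ofReal_re] using norm_vectorFunctional_le (η i) A
  -- One ultrafilter gives limits for every `A` at once, so linearity and positivity pass to the
  -- limit.
  let l : Ultrafilter (Finset Γ × ℕ) := Ultrafilter.of atTop
  have hl : (l : Filter (Finset Γ × ℕ)) ≤ atTop := Ultrafilter.of_le _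
  have exlim (A : H →L[ℂ] H) : ∃ z, Tendsto (fun i => ψ i A) l (𝓝 z) := by
    have hev : ∀ᶠ i in (l : Filter (Finset Γ × ℕ)),
        ψ i A ∈ Metric.closedBall (0 : ℂ) (‖A‖ * 2) := by
      filter_upwards [hl (limone'.eventually (gt_mem_nhds (by norm_num : (1 : ℝ) < 2)))] with i hi
      rw [mem_closedBall_zero_iff]
      exact (bound i A).trans (mul_le_mul_of_nonneg_left hi.le (norm_nonneg _))
    obtain ⟨z, -, hz⟩ := (isCompact_closedBall (0 : ℂ) (‖A‖ * 2)).ultrafilter_le_nhds'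
      (l.map fun i => ψ i A) hev
    exact ⟨z, hz⟩
  choose φ hφ using exlim
  refine ⟨{ toFun := φ, map_add' := fun A B => ?_, map_smul' := fun c A => ?_ }, ?_, fun A => ?_,
    fun A => ?_, fun A => ?_, fun s A => ?_⟩
  · refine tendsto_nhds_unique (hφ (A + B)) ?_
    simpa using (hφ A).add (hφ B)
  · refine tendsto_nhds_unique (hφ (c • A)) ?_
    simpa using (hφ A).const_mul c
  · exact tendsto_nhds_unique (hφ 1) (limone.mono_left hl)
  · have := le_of_tendsto_of_tendsto (hφ A).norm ((limone'.mono_left hl).const_mul ‖A‖)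
      (Eventually.of_forall fun i => bound i A)
    simpa using this
  · refine tendsto_nhds_unique (hφ (star A)) ?_
    simpa [hψ, vectorFunctional_star, Function.comp_def] using
      (continuous_star.tendsto _).comp (hφ A)
  · exact ge_of_tendsto (hφ (star A * A))
      (Eventually.of_forall fun i => vectorFunctional_star_mul_self_nonneg _ _)
  · have h1 := (hφ (U s * A * star (U s : H →L[ℂ] H))).sub (hφ A)
    -- The radicand tends to `2 * 1 - 2 * 1 = 0`, while the other factors stay bounded.
    have h2 : Tendsto (fun i => 2 * ‖A‖ * (√(2 * (ψ i 1).re - 2 * (ψ i (U s)).re) *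
        √((ψ i 1).re))) l (𝓝 0) := by
      have := (((((limone'.const_mul 2).sub ((limre s).const_mul 2)).sqrt).mul
        limone'.sqrt).const_mul (2 * ‖A‖)).mono_left hl
      simpa using this
    have h3 := squeeze_zero_norm
      (fun i => norm_vectorFunctional_conj_sub_le (η i) (U s) A) h2
    exact sub_eq_zero.1 (tendsto_nhds_unique h1 h3)

end InvariantState

/-! ### From an invariant state to an invariant mean on `C(X)`. -/

section InvariantMean

variable {Γ : Type u} {X : Type v} [Group Γ] [TopologicalSpace X] [MulAction Γ X]

/-- The covariance relation: it makes translation of functions a conjugation, so conjugation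
invariance of the state becomes translation invariance of the mean. -/
theorem groupUnitary_conj_functionHom {B : Type v} [CStarAlgebra B] [MulSemiringAction Γ B]
    [IsStarAction Γ B] (s : Γ) (f : B) :
    (functionHom (s • f) : ConvAlgebra Γ B) =
      ((groupUnitary s : unitary (ConvAlgebra Γ B)) : ConvAlgebra Γ B) * functionHom f *
        star ((groupUnitary s : unitary (ConvAlgebra Γ B)) : ConvAlgebra Γ B) := by
  change (SkewMonoidAlgebra.single 1 (s • f) : ConvAlgebra Γ B) = SkewMonoidAlgebra.single s 1 *
    SkewMonoidAlgebra.single 1 f * star (SkewMonoidAlgebra.single s 1)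
  simp [star_single, SkewMonoidAlgebra.single_mul_single]

variable [CompactSpace X] [ContinuousConstSMul Γ X]

/-- If `π|_Γ` weakly contains the trivial representation, then there is an invariant state on
`C(X)`. -/
theorem exists_invariant_mean
    {H : Type w} [NormedAddCommGroup H] [InnerProductSpace ℂ H] [CompleteSpace H]
    (π : CStarCrossed Γ X →⋆ₐ[ℂ] (H →L[ℂ] H))
    (hπ : WeaklyContains (restrictGroup π) (trivialRep Γ)) :
    ∃ μ : C(X, ℂ) →ₗ[ℂ] ℂ, μ 1 = 1 ∧ (∀ f, ‖μ f‖ ≤ ‖f‖) ∧ (∀ f, μ (star f) = star (μ f)) ∧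
      (∀ f : C(X, ℂ), (∀ x, 0 ≤ f x) → 0 ≤ μ f) ∧ ∀ (s : Γ) f, μ (s • f) = μ f := by
  obtain ⟨φ, h1, h2, h3, h4, h5⟩ := exists_invariant_state _ hπ
  let ρ : C(X, ℂ) →⋆ₐ[ℂ] (H →L[ℂ] H) := (π.comp toFull).comp functionHom
  refine ⟨φ ∘ₗ ρ.toAlgHom.toLinearMap, ?_, fun f => ?_, fun f => ?_, fun f hf => ?_,
    fun s f => ?_⟩
  · change φ (ρ 1) = 1
    rw [map_one, h1]
  · exact (h2 _).trans (NonUnitalStarAlgHom.norm_apply_le ρ f)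
  · change φ (ρ (star f)) = star (φ (ρ f))
    rw [map_star, h3]
  -- The state is known to be positive only on elements `star A * A`, so a continuous square root of
  -- `f` is taken.
  · let g : C(X, ℂ) := ⟨fun x => ((√(f x).re : ℝ) : ℂ), by fun_prop⟩
    have hg : f = star g * g := by
      ext x
      change f x = star ((√(f x).re : ℝ) : ℂ) * ((√(f x).re : ℝ) : ℂ)
      have hx := Complex.nonneg_iff.1 (hf x)
      rw [Complex.star_def, Complex.conj_ofReal, ← Complex.ofReal_mul, Real.mul_self_sqrt hx.1]
      exact Complex.ext rfl hx.2.symm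
    change 0 ≤ φ (ρ f)
    rw [hg, map_mul, map_star]
    exact h4 _
  · change φ (π (toFull (functionHom (s • f) : ConvAlgebra Γ C(X, ℂ)))) =
      φ (π (toFull (functionHom f : ConvAlgebra Γ C(X, ℂ))))
    rw [groupUnitary_conj_functionHom, map_mul toFull, map_mul toFull, map_mul π,
      map_mul π, map_star toFull, map_star π]
    exact h5 s _

end InvariantMean

/-! ### Averaging functions on `X × Γ` over `X`. -/

section Averaging

variable {Γ : Type u} {X : Type v} [TopologicalSpace Γ] [TopologicalSpace X]

/-- The section `x ↦ h (x, s)` of a continuous function on `X × Γ`. -/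
noncomputable def sliceAt (h : C(X × Γ, ℂ)) (s : Γ) : C(X, ℂ) := ⟨fun x => h (x, s), by fun_prop⟩

theorem sliceAt_apply (h : C(X × Γ, ℂ)) (s : Γ) (x : X) : sliceAt h s x = h (x, s) := rfl

/-- The base point `s i • x` in the matrix depends on the row. Invariance of `μ` allows the `(i, j)`
slice to be translated by `(s i)⁻¹`, after which all entries refer to a common `x` and the pointwise
inequality can be averaged. -/
theorem IsPositiveDefiniteOn.mean [Group Γ] [MulAction Γ X] [ContinuousConstSMul Γ X] {h : C(X × Γ, ℂ)}
    (hh : IsPositiveDefiniteOn (h : X × Γ → ℂ)) {μ : C(X, ℂ) →ₗ[ℂ] ℂ}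
    (hstar : ∀ f, μ (star f) = star (μ f))
    (hpos : ∀ f : C(X, ℂ), (∀ x, 0 ≤ f x) → 0 ≤ μ f)
    (hinv : ∀ (s : Γ) f, μ (s • f) = μ f) :
    IsPositiveDefinite fun s => μ (sliceAt h s) := by
  intro n s
  have key (i j : Fin n) : μ (sliceAt h (s i * (s j)⁻¹)) =
      μ ((s i)⁻¹ • sliceAt h (s i * (s j)⁻¹)) := (hinv _ _).symm
  have val (i j : Fin n) (x : X) : ((s i)⁻¹ • sliceAt h (s i * (s j)⁻¹)) x =
      h (s i • x, s i * (s j)⁻¹) := by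
    rw [translation_apply, inv_inv, sliceAt_apply]
  refine Matrix.PosSemidef.of_dotProduct_mulVec_nonneg (Matrix.IsHermitian.ext fun i j => ?_)
    fun c => ?_
  · simp only [Matrix.of_apply]
    rw [key, key i j, ← hstar]
    congr 1
    ext x
    change star (((s j)⁻¹ • sliceAt h (s j * (s i)⁻¹)) x) = _
    rw [val, val]
    exact (hh n s x).isHermitian.apply i j
  -- The quadratic form at `c`, as a function of `x`, is pointwise nonnegative.
  · have := hpos (∑ i, ∑ j, (star (c i) * c j) • ((s i)⁻¹ • sliceAt h (s i * (s j)⁻¹)))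
      fun x => by
        have hx := (Matrix.posSemidef_iff_dotProduct_mulVec.1 (hh n s x)).2 c
        simp only [dotProduct, Matrix.mulVec, Finset.mul_sum, Matrix.of_apply,
          Pi.star_apply] at hx
        simp only [ContinuousMap.sum_apply, ContinuousMap.smul_apply, val, smul_eq_mul]
        refine hx.trans_eq (Finset.sum_congr rfl fun i _ => Finset.sum_congr rfl fun j _ => ?_)
        ring
    simp only [map_sum, map_smul, smul_eq_mul, ← key] at this
    simp only [dotProduct, Matrix.mulVec, Finset.mul_sum, Matrix.of_apply, Pi.star_apply]
    refine this.trans_eq (Finset.sum_congr rfl fun i _ => Finset.sum_congr rfl fun j _ => ?_)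
    ring

variable [CompactSpace X] {μ : C(X, ℂ) →ₗ[ℂ] ℂ}

theorem norm_mean_le (hnorm : ∀ f, ‖μ f‖ ≤ ‖f‖) (h : C(X × Γ, ℂ)) (s : Γ) {ε : ℝ} (hε : 0 ≤ ε)
    (hb : ∀ x, ‖h (x, s)‖ ≤ ε) : ‖μ (sliceAt h s)‖ ≤ ε :=
  (hnorm _).trans ((ContinuousMap.norm_le _ hε).2 hb)

theorem tendsto_mean_one (hone : μ 1 = 1) (hnorm : ∀ f, ‖μ f‖ ≤ ‖f‖) {h : ℕ → C(X × Γ, ℂ)}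
    (hh : ∀ K : Set (X × Γ), IsCompact K →
      TendstoUniformlyOn (fun n p => h n p) (fun _ => 1) atTop K) (s : Γ) :
    Tendsto (fun n => μ (sliceAt (h n) s)) atTop (𝓝 1) := by
  rw [Metric.tendsto_nhds]
  intro ε hε
  -- Since `X` is compact, so is `X × {s}`; uniform convergence there is sup-norm convergence of the
  -- slices.
  have hK := Metric.tendstoUniformlyOn_iff.1
    (hh _ ((isCompact_univ (X := X)).prod (isCompact_singleton (x := s)))) (ε / 2) (half_pos hε)
  filter_upwards [hK] with n hn
  rw [dist_eq_norm, ← hone, ← map_sub]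
  refine ((hnorm _).trans ((ContinuousMap.norm_le _ (half_pos hε).le).2 fun x => ?_)).trans_lt
    (half_lt_self hε)
  have := hn (x, s) ⟨Set.mem_univ _, rfl⟩
  rw [dist_comm, dist_eq_norm] at this
  exact this.le

theorem tendsto_mean_cofinite [DiscreteTopology Γ] (hnorm : ∀ f, ‖μ f‖ ≤ ‖f‖) (h : C₀(X × Γ, ℂ)) :
    Tendsto (fun s => μ (sliceAt (h : C(X × Γ, ℂ)) s)) cofinite (𝓝 0) := by
  rw [Metric.tendsto_nhds]
  intro ε hε
  obtain ⟨K, hK, hKε⟩ := mem_cocompact.1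
    (Metric.tendsto_nhds.1 (zero_at_infty h) (ε / 2) (half_pos hε))
  have hfin : (Prod.snd '' K).Finite := (hK.image continuous_snd).finite_of_discrete
  filter_upwards [hfin.compl_mem_cofinite] with s hs
  rw [dist_zero_right]
  refine (norm_mean_le hnorm _ s (half_pos hε).le fun x => ?_).trans_lt (half_lt_self hε)
  have : (x, s) ∈ Kᶜ := fun hx => hs ⟨_, hx, rfl⟩
  have := hKε this
  simp only [Set.mem_ofPred_eq, dist_zero_right] at this
  exact this.le

theorem finite_support_mean [DiscreteTopology Γ] (hnorm : ∀ f, ‖μ f‖ ≤ ‖f‖) (h : C_c(X × Γ, ℂ)) :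
    (Function.support fun s => μ (sliceAt (h : C(X × Γ, ℂ)) s)).Finite := by
  refine ((h.hasCompactSupport.isCompact.image continuous_snd).finite_of_discrete).subset
    fun s hs => ?_
  by_contra hcon
  -- Contractivity with bound `ε = 0`: off the projection of the support the whole slice vanishes.
  refine hs (norm_le_zero_iff.1 (norm_mean_le hnorm _ s le_rfl fun x => ?_))
  have : h (x, s) = 0 := image_eq_zero_of_notMem_tsupport fun hx => hcon ⟨_, hx, rfl⟩
  exact (norm_eq_zero.2 this).le

end Averaging

/-! ### Pulling functions on `Γ` back to `X × Γ`. -/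

section Pullback

variable {Γ : Type u} (X : Type v) [TopologicalSpace Γ] [DiscreteTopology Γ]
  [TopologicalSpace X]

/-- The pullback to `X × Γ` of a function on `Γ`. -/
noncomputable def pullbackFun (h : Γ → ℂ) : C(X × Γ, ℂ) :=
  ⟨fun p => h p.2, continuous_of_discreteTopology.comp continuous_snd⟩

theorem IsPositiveDefinite.pullback [Group Γ] [MulAction Γ X] {h : Γ → ℂ} (hh : IsPositiveDefinite h) :
    IsPositiveDefiniteOn (pullbackFun X h : X × Γ → ℂ) := fun n s _ => hh n s

theorem tendstoUniformlyOn_pullback {h : ℕ → Γ → ℂ} (hh : ∀ s, Tendsto (fun n => h n s) atTop (𝓝 1))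
    {K : Set (X × Γ)} (hK : IsCompact K) :
    TendstoUniformlyOn (fun n p => pullbackFun X (h n) p) (fun _ => 1) atTop K := by
  rw [Metric.tendstoUniformlyOn_iff]
  intro ε hε
  have hfin : (Prod.snd '' K).Finite := (hK.image continuous_snd).finite_of_discrete
  have := (eventually_all_finite hfin).2 fun s _ => Metric.tendsto_nhds.1 (hh s) ε hε
  filter_upwards [this] with n hn p hp
  rw [dist_comm]
  exact hn p.2 ⟨p, hp, rfl⟩

variable [CompactSpace X]

theorem hasCompactSupport_pullback {h : Γ → ℂ} (hh : (Function.support h).Finite) :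
    HasCompactSupport (pullbackFun X h) := by
  have hc : IsCompact (Set.univ ×ˢ Function.support h : Set (X × Γ)) :=
    isCompact_univ.prod hh.isCompact
  refine hc.of_isClosed_subset (isClosed_tsupport _) (closure_minimal ?_ ?_)
  · exact fun p hp => ⟨Set.mem_univ _, hp⟩
  · exact isClosed_univ.prod (isClosed_discrete _)

theorem tendsto_pullback_cocompact {h : Γ → ℂ} (hh : Tendsto h cofinite (𝓝 0)) :
    Tendsto (pullbackFun X h) (cocompact (X × Γ)) (𝓝 0) := by
  rw [← cocompact_eq_cofinite] at hh
  refine hh.comp ?_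
  -- As `X` is compact, leaving compact sets of `X × Γ` means leaving finite sets in the `Γ`
  -- coordinate.
  rw [← coprod_cocompact, cocompact_eq_bot, bot_coprod]
  exact tendsto_comap

end Pullback

/-! ### From properties of the group to properties of the action. -/

section Equivalences

variable {Γ : Type u} {X : Type v} [Group Γ] [TopologicalSpace Γ] [DiscreteTopology Γ]
  [TopologicalSpace X] [CompactSpace X] [MulAction Γ X]

theorem IsAmenableGroup.isAmenableAction (hΓ : IsAmenableGroup Γ) : IsAmenableAction Γ X := by
  obtain ⟨h, hpd, hfin, hlim⟩ := hΓ
  exact ⟨fun n => ⟨pullbackFun X (h n), hasCompactSupport_pullback X (hfin n)⟩,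
    fun n => (hpd n).pullback X, fun K hK => tendstoUniformlyOn_pullback X hlim hK⟩

theorem IsATMenableGroup.isATMenableAction (hΓ : IsATMenableGroup Γ) :
    IsATMenableAction Γ X := by
  obtain ⟨h, hpd, hzero, hlim⟩ := hΓ
  exact ⟨fun n => ⟨pullbackFun X (h n), tendsto_pullback_cocompact X (hzero n)⟩,
    fun n => (hpd n).pullback X, fun K hK => tendstoUniformlyOn_pullback X hlim hK⟩

end Equivalences

end CrossedProduct

theorem mainTheorem6
    {Γ : Type u} [Group Γ] [Countable Γ] [TopologicalSpace Γ] [DiscreteTopology Γ]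
    {X : Type v} [TopologicalSpace X] [CompactSpace X] [T2Space X]
    [MulAction Γ X] [ContinuousConstSMul Γ X]
    {H : Type w} [NormedAddCommGroup H] [InnerProductSpace ℂ H] [CompleteSpace H]
    (π : CrossedProduct.CStarCrossed Γ X →⋆ₐ[ℂ] (H →L[ℂ] H))
    (hπ : CrossedProduct.WeaklyContains
      (CrossedProduct.restrictGroup π) (CrossedProduct.trivialRep Γ)) :
    (CrossedProduct.IsAmenableAction Γ X ↔ CrossedProduct.IsAmenableGroup Γ) ∧
    (CrossedProduct.IsATMenableAction Γ X ↔ CrossedProduct.IsATMenableGroup Γ) := by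
  obtain ⟨μ, hone, hnorm, hstar, hpos, hinv⟩ := CrossedProduct.exists_invariant_mean π hπ
  refine ⟨⟨?_, fun h => h.isAmenableAction⟩, ⟨?_, fun h => h.isATMenableAction⟩⟩
  · rintro ⟨h, hpd, hlim⟩
    exact ⟨fun n s => μ (CrossedProduct.sliceAt (h n : C(X × Γ, ℂ)) s),
      fun n => (hpd n).mean hstar hpos hinv,
      fun n => CrossedProduct.finite_support_mean hnorm (h n),
      CrossedProduct.tendsto_mean_one hone hnorm hlim⟩
  · rintro ⟨h, hpd, hlim⟩
    exact ⟨fun n s => μ (CrossedProduct.sliceAt (h n : C(X × Γ, ℂ)) s),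
      fun n => (hpd n).mean hstar hpos hinv,
      fun n => CrossedProduct.tendsto_mean_cofinite hnorm (h n),
      CrossedProduct.tendsto_mean_one hone hnorm hlim⟩
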